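/- Let $G$ be a locally compact group with left Haar measure, and let $\omega : G \to (0,\infty)$ be a weight, i.e. a continuous function with $\omega(st) \le \omega(s)\omega(t)$ for all $s,t \in G$. Let $L^1(G,\omega)$ be the Beurling algebra of (classes of) measurable $f : G \to \mathbb{C}$ with $\|f\|_\omega = \int_G |f(x)|\,\omega(x)\,dx < \infty$, a Banach algebra under convolution $(f*h)(x) = \int_G f(y)h(y^{-1}x)\,dy$. Write $\hat\otimes$ for the completed projective tensor product and $\pi : L^1(G,\omega)\hat\otimes L^1(G,\omega) \to L^1(G,\omega)$ for the product map $\pi(a\otimes b) = a*b$. Suppose that there is an approximate diagonal for $L^1(G,\omega)$, that is, a net $(m_i)_i$ in $L^1(G,\omega)\hat\otimes L^1(G,\omega)$ with $$a\cdot m_i - m_i\cdot a \to 0 \quad\text{and}\quad a\,\pi(m_i) \to a \qquad\text{for every } a \in L^1(G,\omega),$$ where $a\cdot(b\otimes c) = (a*b)\otimes c$ and $(b\otimes c)\cdot a = b\otimes (c*a)$, such that in addition $$\sup_{g\in G}\,\bigl\| m_i - \delta_g\cdot m_i\cdot\delta_{g^{-1}} \bigr\| \to 0,$$ where $\delta_g\cdot(a\otimes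 b)\cdot\delta_{g^{-1}} = (\delta_g * a)\otimes(b*\delta_{g^{-1}})$, with $(\delta_g * a)(x) = a(g^{-1}x)$ and $(b*\delta_{g^{-1}})(x) = \Delta(g^{-1})\,b(xg)$; here $\Delta$ is the modular function, normalized by $|Eg^{-1}| = \Delta(g)\,|E|$ for the Haar measure $|\cdot|$. (In particular $L^1(G,\omega)$ is pseudo-amenable.) Then $\omega$ is diagonally bounded: $$\sup_{g \in G} \omega(g)\,\omega(g^{-1}) < \infty .$$ -/

import Mathlib

open MeasureTheory Filter Topology
open scoped ENNReal NNReal TensorProduct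

set_option linter.unusedSectionVars false

noncomputable section

/-! ### Approximate diagonals of Banach algebras -/

/-- The projective tensor product `A ⊗̂ A`: the completion of the algebraic tensor product
`A ⊗ A` (over two copies of `A`) for Mathlib's projective (semi)norm. -/
abbrev ProjTensor (A : Type*) [NormedAddCommGroup A] [NormedSpace ℂ A] : Type _ :=
  UniformSpace.Completion (PiTensorProduct ℂ (fun _ : Fin 2 => A))

namespace ProjTensor

section NormedSpace

variable {A : Type*} [NormedAddCommGroup A] [NormedSpace ℂ A]

/-- The elementary tensor `a ⊗ b`. -/
def tmul (a b : A) : ProjTensor A :=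
  ((PiTensorProduct.tprod ℂ ![a, b] : PiTensorProduct ℂ (fun _ : Fin 2 => A)) : ProjTensor A)

/-- The bounded operator `S ⊗ T` on `A ⊗̂ A`. -/
def map (S T : A →L[ℂ] A) : ProjTensor A →L[ℂ] ProjTensor A :=
  (PiTensorProduct.mapL (𝕜 := ℂ) (E := fun _ : Fin 2 => A) (E' := fun _ : Fin 2 => A)
    ![S, T]).completion

theorem map_tmul (S T : A →L[ℂ] A) (a b : A) : map S T (tmul a b) = tmul (S a) (T b) := by
  have h : (fun i : Fin 2 => ((![S, T] : Fin 2 → A →L[ℂ] A) i) ((![a, b] : Fin 2 → A) i))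
      = ![S a, T b] := by
    funext i; fin_cases i <;> rfl
  unfold map tmul
  rw [ContinuousLinearMap.completion_apply_coe, PiTensorProduct.mapL_apply,
    PiTensorProduct.map_tprod]
  exact congrArg (fun v : Fin 2 → A =>
    ((PiTensorProduct.tprod ℂ v : PiTensorProduct ℂ (fun _ : Fin 2 => A)) : ProjTensor A)) h

end NormedSpace

section Algebra

variable {A : Type*} [NonUnitalNormedRing A] [NormedSpace ℂ A] [IsScalarTower ℂ A A]
  [SMulCommClass ℂ A A]

/-- The left module action, `a · (b ⊗ c) = ab ⊗ c`. -/
def lact (a : A) : ProjTensor A →L[ℂ] ProjTensor A :=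
  map (ContinuousLinearMap.mul ℂ A a) (ContinuousLinearMap.id ℂ A)

/-- The right module action, `(b ⊗ c) · a = b ⊗ ca`. -/
def ract (a : A) : ProjTensor A →L[ℂ] ProjTensor A :=
  map (ContinuousLinearMap.id ℂ A) ((ContinuousLinearMap.mul ℂ A).flip a)

variable (A) in
/-- Multiplication as a bounded bilinear map. -/
def mulMultilinear : ContinuousMultilinearMap ℂ (fun _ : Fin 2 => A) A :=
  MultilinearMap.mkContinuous
    { toFun := fun v => v 0 * v 1
      map_update_add' := by
        intro _ v i x y
        fin_cases i <;> simp [Function.update, add_mul, mul_add]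
      map_update_smul' := by
        intro _ v i c x
        fin_cases i <;> simp [Function.update, smul_mul_assoc, mul_smul_comm] } 1
    (fun v => by simpa [Fin.prod_univ_two] using norm_mul_le (v 0) (v 1))

variable (A) in
/-- The product map `π : A ⊗̂ A → A`, `π (a ⊗ b) = ab`. -/
def prodMap [CompleteSpace A] : ProjTensor A →L[ℂ] A :=
  (PiTensorProduct.liftIsometry ℂ (fun _ : Fin 2 => A) A (mulMultilinear A)).extend
    (UniformSpace.Completion.toComplL (𝕜 := ℂ))

theorem prodMap_tmul [CompleteSpace A] (a b : A) : prodMap A (tmul a b) = a * b := by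
  unfold prodMap tmul
  have := ContinuousLinearMap.extend_eq
    (PiTensorProduct.liftIsometry ℂ (fun _ : Fin 2 => A) A (mulMultilinear A))
    (e := UniformSpace.Completion.toComplL (𝕜 := ℂ)
      (E := PiTensorProduct ℂ (fun _ : Fin 2 => A)))
    UniformSpace.Completion.denseRange_coe
    (UniformSpace.Completion.isUniformInducing_coe _)
    (PiTensorProduct.tprod ℂ ![a, b])
  refine this.trans ?_
  simp [mulMultilinear]

end Algebra

end ProjTensor

/-- An approximate diagonal for the Banach algebra `A`: a net `(m i)` in `A ⊗̂ A` such that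
`a · m i - m i · a → 0` and `a π(m i) → a` for every `a ∈ A`. -/
structure IsApproximateDiagonal {A : Type*} [NonUnitalNormedRing A] [NormedSpace ℂ A]
    [IsScalarTower ℂ A A] [SMulCommClass ℂ A A] [CompleteSpace A]
    {ι : Type*} [Preorder ι] (m : ι → ProjTensor A) : Prop where
  commute : ∀ a : A,
    Tendsto (fun i => ProjTensor.lact a (m i) - ProjTensor.ract a (m i)) atTop (𝓝 0)
  approx : ∀ a : A, Tendsto (fun i => a * ProjTensor.prodMap A (m i)) atTop (𝓝 a)

/-! ### Weights and Beurling algebras -/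

/-- A weight on a topological group: a continuous submultiplicative function `G → (0, ∞)`. -/
structure Weight (G : Type*) [TopologicalSpace G] [Group G] where
  toFun : G → ℝ
  continuous_toFun : Continuous toFun
  pos' : ∀ g, 0 < toFun g
  mul_le' : ∀ g h, toFun (g * h) ≤ toFun g * toFun h

namespace Weight

instance {G : Type*} [TopologicalSpace G] [Group G] : CoeFun (Weight G) (fun _ => G → ℝ) :=
  ⟨Weight.toFun⟩

/-- `ω` is diagonally bounded: `sup_g ω(g) ω(g⁻¹) < ∞`. -/
def DiagonallyBounded {G : Type*} [TopologicalSpace G] [Group G] (ω : Weight G) : Prop :=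
  BddAbove (Set.range fun g : G => ω g * ω g⁻¹)

/-- The measure `ω dμ`. -/
def measure {G : Type*} [TopologicalSpace G] [Group G] [MeasurableSpace G] (ω : Weight G)
    (μ : Measure G) : Measure G :=
  μ.withDensity fun x => ENNReal.ofReal (ω x)

end Weight

/-- The Beurling algebra `L¹(G, ω)` as a Banach space: (classes of) measurable `f : G → ℂ` with
`‖f‖ = ∫ |f| ω dμ < ∞`. -/
abbrev Beurling {G : Type*} [TopologicalSpace G] [Group G] [MeasurableSpace G] (ω : Weight G)
    (μ : Measure G) : Type _ :=
  Lp ℂ 1 (ω.measure μ)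

namespace Beurling

section CompOp

variable {X : Type*} [MeasurableSpace X] {ν : Measure X} {T : X → X} {c : ℝ≥0}

theorem quasiMeasurePreserving (hT : Measurable T) (h : ν.map T ≤ (c : ℝ≥0∞) • ν) :
    Measure.QuasiMeasurePreserving T ν ν :=
  ⟨hT, (Measure.absolutelyContinuous_of_le h).trans Measure.smul_absolutelyContinuous⟩

theorem memLp_comp (hT : Measurable T) (h : ν.map T ≤ (c : ℝ≥0∞) • ν) (f : Lp ℂ 1 ν) :
    MemLp (fun x => f (T x)) 1 ν :=
  ((Lp.memLp f).of_measure_le_smul ENNReal.coe_ne_top h).comp_of_map hT.aemeasurable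

/-- Composition `f ↦ f ∘ T`, as a bounded operator on `L¹(ν)`, when `T_* ν ≤ c ν`. -/
def compOp (ν : Measure X) (T : X → X) (c : ℝ≥0) (hT : Measurable T)
    (h : ν.map T ≤ (c : ℝ≥0∞) • ν) : Lp ℂ 1 ν →L[ℂ] Lp ℂ 1 ν :=
  LinearMap.mkContinuous
    { toFun := fun f => (memLp_comp hT h f).toLp _
      map_add' := fun f g => by
        rw [← MemLp.toLp_add]
        exact MemLp.toLp_congr _ _ ((quasiMeasurePreserving hT h).ae (Lp.coeFn_add f g))
      map_smul' := fun a f => by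
        rw [RingHom.id_apply, ← MemLp.toLp_const_smul]
        exact MemLp.toLp_congr _ _ ((quasiMeasurePreserving hT h).ae (Lp.coeFn_smul a f)) } c
    (fun f => by
      change ‖(memLp_comp hT h f).toLp _‖ ≤ _
      rw [Lp.norm_toLp, Lp.norm_def, ← ENNReal.coe_toReal, ← ENNReal.toReal_mul]
      refine ENNReal.toReal_mono (ENNReal.mul_ne_top ENNReal.coe_ne_top (Lp.eLpNorm_ne_top f)) ?_
      have h1 : AEStronglyMeasurable f (ν.map T) :=
        (Lp.aestronglyMeasurable f).mono_ac (quasiMeasurePreserving hT h).2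
      rw [eLpNorm_one_eq_lintegral_enorm, eLpNorm_one_eq_lintegral_enorm,
        ← lintegral_map' (f := fun x => ‖f x‖ₑ) h1.enorm hT.aemeasurable, ← smul_eq_mul,
        ← lintegral_smul_measure]
      exact lintegral_mono' h le_rfl)

theorem compOp_coeFn (hT : Measurable T) (h : ν.map T ≤ (c : ℝ≥0∞) • ν) (f : Lp ℂ 1 ν) :
    compOp ν T c hT h f =ᵐ[ν] fun x => f (T x) :=
  (memLp_comp hT h f).coeFn_toLp

theorem norm_compOp_le (hT : Measurable T) (h : ν.map T ≤ (c : ℝ≥0∞) • ν) (f : Lp ℂ 1 ν) :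
    ‖compOp ν T c hT h f‖ ≤ c * ‖f‖ :=
  (LinearMap.mkContinuous_norm_le _ c.2 _ |> ContinuousLinearMap.le_of_opNorm_le _) f

end CompOp

variable {G : Type*} [TopologicalSpace G] [Group G] [MeasurableSpace G] [BorelSpace G]

theorem ofReal_measurable (ω : Weight G) : Measurable fun x => ENNReal.ofReal (ω x) :=
  ω.continuous_toFun.measurable.ennreal_ofReal

theorem ac_measure (ω : Weight G) (μ : Measure G) : μ ≪ ω.measure μ :=
  withDensity_absolutelyContinuous' (ofReal_measurable ω).aemeasurable
    (Eventually.of_forall fun x => by simp [ω.pos' x])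

theorem aestronglyMeasurable (ω : Weight G) (μ : Measure G) (f : Beurling ω μ) :
    AEStronglyMeasurable f μ :=
  (Lp.aestronglyMeasurable f).mono_ac (ac_measure ω μ)

theorem eLpNorm_eq (ω : Weight G) (μ : Measure G) {f : G → ℂ} (hf : AEStronglyMeasurable f μ) :
    eLpNorm f 1 (ω.measure μ) = ∫⁻ x, ‖(ω x : ℂ) * f x‖ₑ ∂μ := by
  rw [eLpNorm_one_eq_lintegral_enorm, Weight.measure,
    lintegral_withDensity_eq_lintegral_mul₀ (ofReal_measurable ω).aemeasurable hf.enorm]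
  refine lintegral_congr fun x => ?_
  rw [Pi.mul_apply, enorm_mul, ← ofReal_norm (ω x : ℂ), Complex.norm_real,
    Real.norm_of_nonneg (ω.pos' x).le]

theorem integrable_weight_mul (ω : Weight G) (μ : Measure G) (f : Beurling ω μ) :
    Integrable (fun x => (ω x : ℂ) * f x) μ := by
  refine ⟨((Complex.continuous_ofReal.comp ω.continuous_toFun).measurable.aestronglyMeasurable).mul
    (aestronglyMeasurable ω μ f), ?_⟩
  rw [HasFiniteIntegral, ← eLpNorm_eq ω μ (aestronglyMeasurable ω μ f)]
  exact Lp.eLpNorm_lt_top f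

variable [IsTopologicalGroup G]

theorem map_mul_left_le (ω : Weight G) (μ : Measure G) [μ.IsMulLeftInvariant] (g : G) :
    (ω.measure μ).map (fun x => g⁻¹ * x) ≤ ((ω g).toNNReal : ℝ≥0∞) • ω.measure μ := by
  have hm : Measurable fun x : G => g⁻¹ * x := (continuous_const_mul _).measurable
  refine Measure.le_iff.2 fun s hs => ?_
  rw [Measure.map_apply hm hs, Measure.smul_apply, smul_eq_mul, Weight.measure,
    withDensity_apply _ (hm hs), withDensity_apply _ hs, ← lintegral_indicator (hm hs),
    ← lintegral_indicator hs, ← lintegral_mul_left_eq_self _ g,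
    ← lintegral_const_mul _ ((ofReal_measurable ω).indicator hs)]
  refine lintegral_mono fun x => ?_
  by_cases hx : x ∈ s
  · have : g * x ∈ (fun x : G => g⁻¹ * x) ⁻¹' s := by simpa using hx
    rw [Set.indicator_of_mem this, Set.indicator_of_mem hx]
    change _ ≤ ENNReal.ofReal _ * _
    rw [← ENNReal.ofReal_mul (ω.pos' g).le]
    exact ENNReal.ofReal_le_ofReal (ω.mul_le' g x)
  · have : g * x ∉ (fun x : G => g⁻¹ * x) ⁻¹' s := by simpa using hx
    rw [Set.indicator_of_notMem this]
    exact zero_le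

/-- Left translation `(δ_g * f)(x) = f (g⁻¹ x)` on `L¹(G, ω)`. -/
def lTranslate (ω : Weight G) (μ : Measure G) [μ.IsMulLeftInvariant] (g : G) :
    Beurling ω μ →L[ℂ] Beurling ω μ :=
  compOp (ω.measure μ) (fun x => g⁻¹ * x) (ω g).toNNReal
    (continuous_const_mul _).measurable (map_mul_left_le ω μ g)

theorem lTranslate_coeFn (ω : Weight G) (μ : Measure G) [μ.IsMulLeftInvariant] (g : G)
    (f : Beurling ω μ) : lTranslate ω μ g f =ᵐ[μ] fun x => f (g⁻¹ * x) :=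
  (ac_measure ω μ).ae_le (compOp_coeFn _ _ f)

theorem norm_lTranslate_le (ω : Weight G) (μ : Measure G) [μ.IsMulLeftInvariant] (g : G)
    (f : Beurling ω μ) : ‖lTranslate ω μ g f‖ ≤ ω g * ‖f‖ := by
  have := norm_compOp_le (continuous_const_mul _).measurable (map_mul_left_le ω μ g) f
  rwa [Real.coe_toNNReal _ (ω.pos' g).le] at this

variable [LocallyCompactSpace G] (ω : Weight G) (μ : Measure G) [μ.IsHaarMeasure] [μ.Regular]

theorem map_mul_right (g : G) : μ.map (fun x => x * g) = (Measure.modularCharacter g : ℝ≥0) • μ := by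
  have : (μ.map (fun x => x * g)).Regular := Measure.Regular.map (Homeomorph.mulRight g)
  refine (Measure.isMulLeftInvariant_eq_smul_of_regular (μ.map (fun x => x * g)) μ).trans ?_
  rw [← Measure.modularCharacterFun_eq_haarScalarFactor]
  rfl

theorem map_mul_right_le (g : G) :
    (ω.measure μ).map (fun x => x * g⁻¹) ≤
      ((Measure.modularCharacter g⁻¹ * (ω g).toNNReal : ℝ≥0) : ℝ≥0∞) • ω.measure μ := by
  have hm : Measurable fun x : G => x * g⁻¹ := (continuous_mul_const _).measurable
  refine Measure.le_iff.2 fun s hs => ?_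
  have hmeas : Measurable fun x => s.indicator (fun x => ENNReal.ofReal (ω (x * g))) x :=
    ((ofReal_measurable ω).comp (continuous_mul_const g).measurable).indicator hs
  have h1 : ∫⁻ x, ((fun x : G => x * g⁻¹) ⁻¹' s).indicator (fun x => ENNReal.ofReal (ω x)) x ∂μ
      = ∫⁻ x, s.indicator (fun x => ENNReal.ofReal (ω (x * g))) x ∂(μ.map fun x => x * g⁻¹) := by
    rw [lintegral_map hmeas hm]
    refine lintegral_congr fun x => ?_
    by_cases hx : x * g⁻¹ ∈ s
    · rw [Set.indicator_of_mem hx,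
        Set.indicator_of_mem (show x ∈ (fun x : G => x * g⁻¹) ⁻¹' s from hx)]
      simp
    · rw [Set.indicator_of_notMem hx,
        Set.indicator_of_notMem (show x ∉ (fun x : G => x * g⁻¹) ⁻¹' s from hx)]
  rw [Measure.map_apply hm hs, Measure.smul_apply, smul_eq_mul, Weight.measure,
    withDensity_apply _ (hm hs), withDensity_apply _ hs, ← lintegral_indicator (hm hs),
    ← lintegral_indicator hs, h1, map_mul_right, lintegral_smul_measure, ENNReal.coe_mul, mul_assoc,
    ← lintegral_const_mul _ ((ofReal_measurable ω).indicator hs)]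
  refine mul_le_mul_right (lintegral_mono fun x => ?_) _
  by_cases hx : x ∈ s
  · rw [Set.indicator_of_mem hx, Set.indicator_of_mem hx]
    change _ ≤ ENNReal.ofReal _ * _
    rw [← ENNReal.ofReal_mul (ω.pos' g).le, mul_comm (ω g)]
    exact ENNReal.ofReal_le_ofReal (ω.mul_le' x g)
  · rw [Set.indicator_of_notMem hx]
    exact zero_le

/-- Right translation `(f * δ_g)(x) = Δ(g) f (x g⁻¹)` on `L¹(G, ω)`, where `Δ` is the modular
character, normalized by `μ (E g⁻¹) = Δ(g) μ(E)`. -/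
def rTranslate (g : G) : Beurling ω μ →L[ℂ] Beurling ω μ :=
  ((Measure.modularCharacter g : ℝ≥0) : ℂ) •
    compOp (ω.measure μ) (fun x => x * g⁻¹) (Measure.modularCharacter g⁻¹ * (ω g).toNNReal)
      (continuous_mul_const _).measurable (map_mul_right_le ω μ g)

theorem rTranslate_coeFn (g : G) (f : Beurling ω μ) :
    rTranslate ω μ g f =ᵐ[μ] fun x => ((Measure.modularCharacter g : ℝ≥0) : ℂ) * f (x * g⁻¹) := by
  have h1 := compOp_coeFn (continuous_mul_const _).measurable (map_mul_right_le ω μ g) f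
  refine (ac_measure ω μ).ae_le ?_
  filter_upwards [Lp.coeFn_smul ((Measure.modularCharacter g : ℝ≥0) : ℂ)
    (compOp (ω.measure μ) (fun x => x * g⁻¹) (Measure.modularCharacter g⁻¹ * (ω g).toNNReal)
      (continuous_mul_const _).measurable (map_mul_right_le ω μ g) f), h1] with x h2 h3
  rw [← h3]
  exact h2

theorem norm_eq (f : Beurling ω μ) : ‖f‖ = ∫ x, ‖(ω x : ℂ) * f x‖ ∂μ := by
  rw [Lp.norm_def, eLpNorm_eq ω μ (aestronglyMeasurable ω μ f),
    integral_norm_eq_lintegral_enorm (integrable_weight_mul ω μ f).1]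

theorem memLp_of_compactSupport {k : G → ℂ} (hk : Continuous k) (hc : HasCompactSupport k) :
    MemLp k 1 (ω.measure μ) := by
  have h := hk.memLp_of_hasCompactSupport (μ := μ) (p := 1) hc
  refine ⟨h.1.mono_ac (withDensity_absolutelyContinuous _ _), ?_⟩
  rw [eLpNorm_eq ω μ h.1, ← eLpNorm_one_eq_lintegral_enorm]
  exact (((Complex.continuous_ofReal.comp ω.continuous_toFun).mul hk).memLp_of_hasCompactSupport
    (μ := μ) (p := 1) hc.mul_left).2

/-- Density of `C_c(G)` in `L¹(μ)`. -/
theorem exists_compactSupport_lintegral_sub_le {f : G → ℂ} (hf : Integrable f μ) {ε : ℝ≥0∞}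
    (hε : ε ≠ 0) :
    ∃ k : G → ℂ, eLpNorm (f - k) 1 μ ≤ ε ∧ Continuous k ∧ HasCompactSupport k := by
  refine MemLp.induction_dense ENNReal.one_ne_top
    (fun k : G → ℂ => Continuous k ∧ HasCompactSupport k) ?_ ?_ ?_
    (memLp_one_iff_integrable.2 hf) hε
  · intro c s hs hμs ε hε
    have hD0 : 2 * (‖c‖ₑ + 1) ≠ 0 := by simp
    have hDt : 2 * (‖c‖ₑ + 1) ≠ ∞ := by finiteness
    have hδ : ε / (2 * (‖c‖ₑ + 1)) ≠ 0 := (ENNReal.div_pos hε hDt).ne'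
    obtain ⟨U, hsU, hU, -, hUs⟩ := hs.exists_isOpen_sdiff_lt hμs.ne hδ
    obtain ⟨K, hKs, hK, hKc, hsK⟩ := hs.exists_isCompact_isClosed_sdiff_lt hμs.ne hδ
    obtain ⟨φ, h1, h0, hc, h01⟩ := exists_continuous_one_zero_of_isCompact hK
      hU.isClosed_compl (Set.disjoint_compl_right_iff_subset.2 (hKs.trans hsU))
    refine ⟨fun x => (φ x : ℂ) * c, ?_, by fun_prop,
      (hc.comp_left (g := fun r : ℝ => (r : ℂ)) (by simp)).mul_right⟩
    have hb : ∀ x, ‖(φ x : ℂ) * c - s.indicator (fun _ => c) x‖ₑ ≤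
        (U \ K).indicator (fun _ => ‖c‖ₑ) x := fun x => by
      by_cases hxK : x ∈ K
      · simp [h1 hxK, hKs hxK]
      by_cases hxU : x ∈ U
      · rw [Set.indicator_of_mem (show x ∈ U \ K from ⟨hxU, hxK⟩), enorm_le_iff_norm_le]
        obtain ⟨h2, h3⟩ := h01 x
        by_cases hxs : x ∈ s
        · rw [Set.indicator_of_mem hxs, ← sub_one_mul, norm_mul, ← Complex.ofReal_one,
            ← Complex.ofReal_sub, Complex.norm_real, Real.norm_eq_abs]
          exact mul_le_of_le_one_left (norm_nonneg _) (abs_le.2 ⟨by linarith, by linarith⟩)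
        · rw [Set.indicator_of_notMem hxs, sub_zero, norm_mul, Complex.norm_real,
            Real.norm_of_nonneg h2]
          exact mul_le_of_le_one_left (norm_nonneg _) h3
      · have hxs : x ∉ s := fun h => hxU (hsU h)
        simp [h0 hxU, hxs]
    rw [eLpNorm_one_eq_lintegral_enorm]
    calc _ ≤ ∫⁻ x, (U \ K).indicator (fun _ => ‖c‖ₑ) x ∂μ := lintegral_mono hb
      _ = ‖c‖ₑ * μ (U \ K) := lintegral_indicator_const (hU.measurableSet.diff hKc.measurableSet) _
      _ ≤ (‖c‖ₑ + 1) * (ε / (2 * (‖c‖ₑ + 1)) + ε / (2 * (‖c‖ₑ + 1))) := by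
          refine mul_le_mul' le_self_add ?_
          have : U \ K ⊆ (U \ s) ∪ (s \ K) := fun x hx => by
            by_cases h : x ∈ s
            · exact Or.inr ⟨h, hx.2⟩
            · exact Or.inl ⟨hx.1, h⟩
          exact (measure_mono this).trans ((measure_union_le _ _).trans
            (add_le_add hUs.le hsK.le))
      _ = 2 * (‖c‖ₑ + 1) * (ε / (2 * (‖c‖ₑ + 1))) := by ring
      _ = ε := ENNReal.mul_div_cancel hD0 hDt
  · exact fun f g hf hg => ⟨hf.1.add hg.1, hf.2.add hg.2⟩
  · exact fun f hf => (hf.1.stronglyMeasurable_of_hasCompactSupport hf.2).aestronglyMeasurable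

theorem quasi_mul_left (y : G) : Measure.QuasiMeasurePreserving (fun x => y * x) μ μ :=
  (measurePreserving_mul_left μ y).quasiMeasurePreserving

/-- Continuous functions of compact support are dense in `L¹(G, ω)`. -/
theorem exists_compactSupport_norm_sub_le (f : Beurling ω μ) {ε : ℝ} (hε : 0 < ε) :
    ∃ (k : G → ℂ) (hk : Continuous k) (hc : HasCompactSupport k),
      ‖f - (memLp_of_compactSupport ω μ hk hc).toLp k‖ ≤ ε := by
  have hω : Continuous fun x => (ω x : ℂ) := Complex.continuous_ofReal.comp ω.continuous_toFun
  have hω0 : ∀ x, (ω x : ℂ) ≠ 0 := fun x => by exact_mod_cast (ω.pos' x).ne'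
  obtain ⟨k, hle, hk, hc⟩ := exists_compactSupport_lintegral_sub_le μ
    (integrable_weight_mul ω μ f) (ENNReal.ofReal_pos.2 hε).ne'
  have hk' : Continuous fun x => (ω x : ℂ)⁻¹ * k x := (hω.inv₀ hω0).mul hk
  have hc' : HasCompactSupport fun x => (ω x : ℂ)⁻¹ * k x := hc.mul_left
  refine ⟨fun x => (ω x : ℂ)⁻¹ * k x, hk', hc', ?_⟩
  rw [norm_eq]
  rw [eLpNorm_one_eq_lintegral_enorm] at hle
  refine le_trans (le_of_eq (integral_congr_ae (g := fun x => ‖(ω x : ℂ) * f x - k x‖) ?_)) ?_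
  swap
  · have hm : AEStronglyMeasurable (fun x => (ω x : ℂ) * f x - k x) μ :=
      (integrable_weight_mul ω μ f).1.sub
        (hk.stronglyMeasurable_of_hasCompactSupport hc).aestronglyMeasurable
    rw [integral_norm_eq_lintegral_enorm hm]
    exact ENNReal.toReal_le_of_le_ofReal hε.le hle
  filter_upwards [(ac_measure ω μ).ae_le (Lp.coeFn_sub f
      ((memLp_of_compactSupport ω μ hk' hc').toLp _)),
    (ac_measure ω μ).ae_le
      (memLp_of_compactSupport ω μ hk' hc').coeFn_toLp] with x h1 h2
  rw [h1, Pi.sub_apply, h2, mul_sub, mul_inv_cancel_left₀ (hω0 x)]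

theorem tendsto_lTranslate_compactSupport {k : G → ℂ} (hk : Continuous k)
    (hc : HasCompactSupport k) (y₀ : G) :
    Tendsto (fun y => ‖lTranslate ω μ y ((memLp_of_compactSupport ω μ hk hc).toLp k) -
      lTranslate ω μ y₀ ((memLp_of_compactSupport ω μ hk hc).toLp k)‖) (𝓝 y₀) (𝓝 0) := by
  have hω : Continuous fun x => (ω x : ℂ) := Complex.continuous_ofReal.comp ω.continuous_toFun
  have key : ∀ y, lTranslate ω μ y ((memLp_of_compactSupport ω μ hk hc).toLp k) =ᵐ[μ]
      fun x => k (y⁻¹ * x) := fun y => by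
    filter_upwards [lTranslate_coeFn ω μ y ((memLp_of_compactSupport ω μ hk hc).toLp k),
      (quasi_mul_left μ y⁻¹).ae
        ((ac_measure ω μ).ae_le (memLp_of_compactSupport ω μ hk hc).coeFn_toLp)] with x h1 h2
    rw [h1, h2]
  have hn : ∀ y, ‖lTranslate ω μ y ((memLp_of_compactSupport ω μ hk hc).toLp k) -
      lTranslate ω μ y₀ ((memLp_of_compactSupport ω μ hk hc).toLp k)‖ =
      ∫ x, ‖(ω x : ℂ) * (k (y⁻¹ * x) - k (y₀⁻¹ * x))‖ ∂μ := fun y => by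
    rw [norm_eq]
    refine integral_congr_ae ?_
    filter_upwards [key y, key y₀, (ac_measure ω μ).ae_le (Lp.coeFn_sub
      (lTranslate ω μ y ((memLp_of_compactSupport ω μ hk hc).toLp k))
      (lTranslate ω μ y₀ ((memLp_of_compactSupport ω μ hk hc).toLp k)))] with x h1 h2 h3
    simp only [h3, Pi.sub_apply, h1, h2]
  simp only [hn]
  obtain ⟨s, hs, hsn⟩ := exists_compact_mem_nhds y₀
  have hcont : ContinuousOn
      (fun y => ∫ x, ‖(ω x : ℂ) * (k (y⁻¹ * x) - k (y₀⁻¹ * x))‖ ∂μ) s := by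
    refine continuousOn_integral_of_compact_support (hs.mul hc.isCompact) ?_ ?_
    · exact Continuous.continuousOn (by unfold Function.uncurry; have := ω.continuous_toFun; fun_prop)
    · intro y x hy hx
      have h0 : ∀ z ∈ s, k (z⁻¹ * x) = 0 := fun z hz => by
        refine image_eq_zero_of_notMem_tsupport fun hzx => hx ?_
        exact ⟨z, hz, z⁻¹ * x, hzx, by simp⟩
      simp [h0 y hy, h0 y₀ (mem_of_mem_nhds hsn)]
  have := (hcont.continuousAt hsn).tendsto
  simpa using this

/-- Left translation is strongly continuous on `L¹(G, ω)`. -/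
theorem continuous_lTranslate (f : Beurling ω μ) : Continuous fun y => lTranslate ω μ y f := by
  rw [continuous_iff_continuousAt]
  intro y₀
  rw [ContinuousAt, tendsto_iff_norm_sub_tendsto_zero]
  refine Metric.tendsto_nhds.2 fun ε hε => ?_
  have hp : 0 < 2 * ω y₀ + 1 := by have := ω.pos' y₀; positivity
  obtain ⟨k, hk, hc, hle⟩ := exists_compactSupport_norm_sub_le ω μ f
    (ε := ε / 2 / (2 * ω y₀ + 1)) (by positivity)
  filter_upwards [(tendsto_lTranslate_compactSupport ω μ hk hc y₀).eventually
      (gt_mem_nhds (half_pos hε)),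
    (ω.continuous_toFun.tendsto y₀).eventually (gt_mem_nhds (lt_add_one (ω y₀)))] with y h1 h2
  set K := (memLp_of_compactSupport ω μ hk hc).toLp k
  have e : lTranslate ω μ y f - lTranslate ω μ y₀ f =
      lTranslate ω μ y (f - K) - lTranslate ω μ y₀ (f - K) +
        (lTranslate ω μ y K - lTranslate ω μ y₀ K) := by
    rw [map_sub, map_sub]; abel
  have h3 : (ω y + ω y₀) * ‖f - K‖ ≤ (2 * ω y₀ + 1) * (ε / 2 / (2 * ω y₀ + 1)) :=
    mul_le_mul (by linarith) hle (norm_nonneg _) hp.le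
  rw [mul_div_cancel₀ _ hp.ne'] at h3
  rw [Real.dist_eq, sub_zero, abs_of_nonneg (norm_nonneg _), e]
  calc _ ≤ ‖lTranslate ω μ y (f - K)‖ + ‖lTranslate ω μ y₀ (f - K)‖ +
        ‖lTranslate ω μ y K - lTranslate ω μ y₀ K‖ :=
        (norm_add_le _ _).trans (add_le_add_left (norm_sub_le _ _) _)
    _ ≤ ω y * ‖f - K‖ + ω y₀ * ‖f - K‖ + ‖lTranslate ω μ y K - lTranslate ω μ y₀ K‖ :=
        add_le_add_left (add_le_add (norm_lTranslate_le ω μ y _)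
          (norm_lTranslate_le ω μ y₀ _)) _
    _ < ε := by linarith

/-- The integrand of the convolution product is Bochner integrable. -/
theorem integrable_smul_lTranslate (f g : Beurling ω μ) :
    Integrable (fun y => f y • lTranslate ω μ y g) μ := by
  have hmeas : AEStronglyMeasurable (fun y => f y • lTranslate ω μ y g) μ := by
    choose k hk hc hle using fun n : ℕ =>
      exists_compactSupport_norm_sub_le ω μ f (Nat.one_div_pos_of_nat (α := ℝ) (n := n))
    have ht : TendstoInMeasure (ω.measure μ) k atTop f := by
      refine tendstoInMeasure_of_tendsto_eLpNorm one_ne_zero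
        (fun n => (memLp_of_compactSupport ω μ (hk n) (hc n)).1) (Lp.aestronglyMeasurable f) ?_
      have h1 : Tendsto (fun n : ℕ => ENNReal.ofReal (1 / ((n : ℝ) + 1))) atTop (𝓝 0) := by
        simpa using ENNReal.tendsto_ofReal tendsto_one_div_add_atTop_nhds_zero_nat
      refine tendsto_of_tendsto_of_tendsto_of_le_of_le tendsto_const_nhds h1
        (fun _ => zero_le) fun n => ?_
      have h2 : eLpNorm (k n - (f : G → ℂ)) 1 (ω.measure μ) =
          ‖f - (memLp_of_compactSupport ω μ (hk n) (hc n)).toLp (k n)‖ₑ := by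
        rw [eLpNorm_sub_comm, Lp.enorm_def]
        refine eLpNorm_congr_ae ?_
        filter_upwards [Lp.coeFn_sub f ((memLp_of_compactSupport ω μ (hk n) (hc n)).toLp (k n)),
          (memLp_of_compactSupport ω μ (hk n) (hc n)).coeFn_toLp] with x h3 h4
        rw [h3, Pi.sub_apply, Pi.sub_apply, h4]
      change eLpNorm (k n - (f : G → ℂ)) 1 (ω.measure μ) ≤ _
      rw [h2, ← ofReal_norm]
      exact ENNReal.ofReal_le_ofReal (hle n)
    obtain ⟨ns, -, hns⟩ := ht.exists_seq_tendsto_ae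
    refine aestronglyMeasurable_of_tendsto_ae (u := atTop)
      (f := fun n y => k (ns n) y • lTranslate ω μ y g) (fun n => ?_) ?_
    · exact (Continuous.stronglyMeasurable_of_hasCompactSupport
        ((hk _).smul (continuous_lTranslate ω μ g)) (hc _).smul_right).aestronglyMeasurable
    · filter_upwards [(ac_measure ω μ).ae_le hns] with y hy
      exact hy.smul_const _
  refine ((integrable_weight_mul ω μ f).norm.mul_const ‖g‖).mono' hmeas
    (Eventually.of_forall fun y => ?_)
  rw [norm_smul, norm_mul, Complex.norm_real, Real.norm_of_nonneg (ω.pos' y).le,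
    mul_comm (ω y), mul_assoc]
  exact mul_le_mul_of_nonneg_left (norm_lTranslate_le ω μ y g) (norm_nonneg _)

/-- The convolution product `f * g = ∫ f(y) (δ_y * g) dy`, a Bochner integral in `L¹(G, ω)`; as
`(δ_y * g)(x) = g (y⁻¹ x)`, this is the usual `(f * g)(x) = ∫ f(y) g(y⁻¹ x) dy`. -/
def conv (f g : Beurling ω μ) : Beurling ω μ := ∫ y, f y • lTranslate ω μ y g ∂μ

theorem norm_conv_le (f g : Beurling ω μ) : ‖conv ω μ f g‖ ≤ ‖f‖ * ‖g‖ := by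
  rw [conv, norm_eq ω μ f, ← integral_mul_const]
  refine norm_integral_le_of_norm_le ((integrable_weight_mul ω μ f).norm.mul_const ‖g‖)
    (Eventually.of_forall fun y => ?_)
  rw [norm_smul, norm_mul, Complex.norm_real, Real.norm_of_nonneg (ω.pos' y).le,
    mul_comm (ω y), mul_assoc]
  exact mul_le_mul_of_nonneg_left (norm_lTranslate_le ω μ y g) (norm_nonneg _)

theorem add_conv (f g h : Beurling ω μ) : conv ω μ (f + g) h = conv ω μ f h + conv ω μ g h := by
  rw [conv, conv, conv, ← integral_add (integrable_smul_lTranslate ω μ f h)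
    (integrable_smul_lTranslate ω μ g h)]
  refine integral_congr_ae ?_
  filter_upwards [(ac_measure ω μ).ae_le (Lp.coeFn_add f g)] with y hy
  simp only [hy, Pi.add_apply, add_smul]

theorem conv_add (f g h : Beurling ω μ) : conv ω μ f (g + h) = conv ω μ f g + conv ω μ f h := by
  rw [conv, conv, conv, ← integral_add (integrable_smul_lTranslate ω μ f g)
    (integrable_smul_lTranslate ω μ f h)]
  simp only [map_add, smul_add]

theorem smul_conv (c : ℂ) (f g : Beurling ω μ) : conv ω μ (c • f) g = c • conv ω μ f g := by
  rw [conv, conv, ← integral_smul]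
  refine integral_congr_ae ?_
  filter_upwards [(ac_measure ω μ).ae_le (Lp.coeFn_smul c f)] with y hy
  simp only [hy, Pi.smul_apply, smul_eq_mul, mul_smul]

theorem conv_smul (c : ℂ) (f g : Beurling ω μ) : conv ω μ f (c • g) = c • conv ω μ f g := by
  rw [conv, conv, ← integral_smul]
  simp only [map_smul, smul_comm c]

theorem lTranslate_mul (y z : G) (f : Beurling ω μ) :
    lTranslate ω μ (y * z) f = lTranslate ω μ y (lTranslate ω μ z f) := by
  refine Lp.ext ((withDensity_absolutelyContinuous _ _ : ω.measure μ ≪ μ).ae_le ?_)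
  filter_upwards [lTranslate_coeFn ω μ (y * z) f, lTranslate_coeFn ω μ y (lTranslate ω μ z f),
    (quasi_mul_left μ y⁻¹).ae (lTranslate_coeFn ω μ z f)] with x h1 h2 h3
  rw [h1, h2, h3, mul_inv_rev, mul_assoc]

theorem conv_lTranslate (y : G) (f g : Beurling ω μ) :
    conv ω μ (lTranslate ω μ y f) g = lTranslate ω μ y (conv ω μ f g) := by
  rw [conv, conv, ← ContinuousLinearMap.integral_comp_comm _
    (integrable_smul_lTranslate ω μ f g)]
  rw [← integral_mul_left_eq_self (fun z => (lTranslate ω μ y f) z • lTranslate ω μ z g) y]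
  refine integral_congr_ae ?_
  filter_upwards [(quasi_mul_left μ y).ae (lTranslate_coeFn ω μ y f)] with z hz
  simp only [hz, inv_mul_cancel_left, lTranslate_mul, map_smul]

theorem conv_assoc (f g h : Beurling ω μ) : conv ω μ (conv ω μ f g) h = conv ω μ f (conv ω μ g h) := by
  let T : Beurling ω μ →L[ℂ] Beurling ω μ := LinearMap.mkContinuous
    { toFun := fun f => conv ω μ f h
      map_add' := fun a b => add_conv ω μ a b h
      map_smul' := fun c a => smul_conv ω μ c a h } ‖h‖
    (fun f => (norm_conv_le ω μ f h).trans_eq (mul_comm _ _))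
  change T (∫ y, f y • lTranslate ω μ y g ∂μ) = _
  rw [← ContinuousLinearMap.integral_comp_comm _ (integrable_smul_lTranslate ω μ f g),
    conv.eq_def ω μ f]
  refine integral_congr_ae (Eventually.of_forall fun y => ?_)
  change T (f y • lTranslate ω μ y g) = f y • lTranslate ω μ y (conv ω μ g h)
  rw [map_smul, ← conv_lTranslate]
  rfl

/-- The Beurling algebra `L¹(G, ω)` is a Banach algebra under convolution. -/
instance : NonUnitalNormedRing (Beurling ω μ) where
  __ := (inferInstance : NormedAddCommGroup (Beurling ω μ))
  mul := conv ω μ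
  left_distrib := conv_add ω μ
  right_distrib := add_conv ω μ
  zero_mul := fun f => (by simpa using smul_conv ω μ 0 0 f : conv ω μ 0 f = 0)
  mul_zero := fun f => (by simpa using conv_smul ω μ 0 f 0 : conv ω μ f 0 = 0)
  mul_assoc := conv_assoc ω μ
  norm_mul_le := norm_conv_le ω μ

theorem mul_def (f g : Beurling ω μ) : f * g = ∫ y, f y • lTranslate ω μ y g ∂μ := rfl

instance : IsScalarTower ℂ (Beurling ω μ) (Beurling ω μ) := ⟨fun c f g => smul_conv ω μ c f g⟩

instance : SMulCommClass ℂ (Beurling ω μ) (Beurling ω μ) :=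
  ⟨fun c f g => (conv_smul ω μ c f g).symm⟩

/-- `δ_g · m · δ_{g⁻¹}` for `m ∈ L¹(G, ω) ⊗̂ L¹(G, ω)`, where
`δ_g · (a ⊗ b) · δ_{g⁻¹} = (δ_g * a) ⊗ (b * δ_{g⁻¹})`. -/
def conjTensor (g : G) : ProjTensor (Beurling ω μ) →L[ℂ] ProjTensor (Beurling ω μ) :=
  ProjTensor.map (lTranslate ω μ g) (rTranslate ω μ g⁻¹)

end Beurling

end

noncomputable section

namespace ProjTensor

variable {A : Type*} [NormedAddCommGroup A] [NormedSpace ℂ A]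

theorem continuous_tmul : Continuous fun p : A × A => tmul p.1 p.2 := by
  refine (UniformSpace.Completion.continuous_coe _).comp
    ((PiTensorProduct.tprodL ℂ (E := fun _ : Fin 2 => A)).cont.comp
      (continuous_pi fun i => ?_))
  fin_cases i
  · exact continuous_fst
  · exact continuous_snd

theorem induction_on {p : ProjTensor A → Prop} (m : ProjTensor A) (hp : IsClosed {m | p m})
    (tmul : ∀ (c : ℂ) (a b : A), p (c • tmul a b)) (add : ∀ x y, p x → p y → p (x + y)) : p m := by
  refine UniformSpace.Completion.induction_on m hp fun t => ?_
  refine PiTensorProduct.induction_on (motive := fun t => p t) t (fun c v => ?_) fun x y hx hy => ?_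
  · have hv : v = ![v 0, v 1] := by funext i; fin_cases i <;> rfl
    rw [UniformSpace.Completion.coe_smul, hv]
    exact tmul c (v 0) (v 1)
  · rw [UniformSpace.Completion.coe_add]
    exact add _ _ hx hy

theorem norm_map_le (S T : A →L[ℂ] A) (m : ProjTensor A) : ‖map S T m‖ ≤ ‖S‖ * ‖T‖ * ‖m‖ := by
  refine UniformSpace.Completion.induction_on m
    (isClosed_le (map S T).continuous.norm (continuous_const.mul continuous_norm)) fun t => ?_
  rw [map, ContinuousLinearMap.completion_apply_coe, UniformSpace.Completion.norm_coe,
    UniformSpace.Completion.norm_coe]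
  refine ContinuousLinearMap.le_of_opNorm_le _ ?_ t
  simpa [Fin.prod_univ_two] using PiTensorProduct.opNorm_mapL (𝕜 := ℂ)
    (E := fun _ : Fin 2 => A) (E' := fun _ : Fin 2 => A) (![S, T] : Fin 2 → A →L[ℂ] A)

theorem map_map (S T S' T' : A →L[ℂ] A) (m : ProjTensor A) :
    map S T (map S' T' m) = map (S.comp S') (T.comp T') m := by
  refine induction_on m (isClosed_eq ((map S T).continuous.comp (map S' T').continuous)
    (map _ _).continuous) (fun c a b => ?_) fun x y hx hy => ?_
  · simp [map_tmul]
  · simp only [Function.comp_apply, map_add] at hx hy ⊢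
    rw [hx, hy]

/-- If contractions `P n` converge strongly to the identity, then so do `P n ⊗ P n`. -/
theorem tendsto_map {P : ℕ → A →L[ℂ] A} (hP : ∀ n, ‖P n‖ ≤ 1)
    (h : ∀ a, Tendsto (fun n => P n a) atTop (𝓝 a)) (m : ProjTensor A) :
    Tendsto (fun n => map (P n) (P n) m) atTop (𝓝 m) := by
  have hle : ∀ n, ‖map (P n) (P n)‖ ≤ 1 := fun n =>
    ContinuousLinearMap.opNorm_le_bound _ zero_le_one fun t =>
      (norm_map_le _ _ t).trans (mul_le_mul_of_nonneg_right
        (mul_le_one₀ (hP n) (norm_nonneg _) (hP n)) (norm_nonneg _))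
  have heq : Equicontinuous fun n => (map (P n) (P n) : ProjTensor A → ProjTensor A) :=
    (LipschitzWith.uniformEquicontinuous _ 1 fun n =>
      (map (P n) (P n)).lipschitz.weaken (hle n)).equicontinuous
  refine induction_on m (heq.isClosed_setOfPred_tendsto continuous_id) (fun c a b => ?_)
    fun x y hx hy => ?_
  · simp only [map_smul, map_tmul, id]
    exact (((continuous_tmul (A := A)).tendsto (a, b)).comp
      ((h a).prodMk_nhds (h b))).const_smul c
  · simp only [map_add]
    exact hx.add hy

end ProjTensor

namespace Beurling

section Restrict

variable {X : Type*} [MeasurableSpace X]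

/-- Multiplication by the indicator function of `s`, as a bounded operator on `L¹(ν)`. -/
def restrict (ν : Measure X) {s : Set X} (hs : MeasurableSet s) : Lp ℂ 1 ν →L[ℂ] Lp ℂ 1 ν :=
  LinearMap.mkContinuous
    { toFun := fun f => ((Lp.memLp f).indicator hs).toLp _
      map_add' := fun f g => by
        rw [← MemLp.toLp_add]
        refine MemLp.toLp_congr _ _ ?_
        filter_upwards [Lp.coeFn_add f g] with x hx
        by_cases h : x ∈ s
        · simpa [h] using hx
        · simp [h]
      map_smul' := fun a f => by
        rw [RingHom.id_apply, ← MemLp.toLp_const_smul]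
        refine MemLp.toLp_congr _ _ ?_
        filter_upwards [Lp.coeFn_smul a f] with x hx
        by_cases h : x ∈ s
        · simpa [h] using hx
        · simp [h] } 1
    (fun f => by
      change ‖((Lp.memLp f).indicator hs).toLp _‖ ≤ _
      rw [one_mul, Lp.norm_toLp, Lp.norm_def]
      exact ENNReal.toReal_mono (Lp.eLpNorm_ne_top f) (eLpNorm_indicator_le _))

variable {ν : Measure X} {s : Set X}

theorem restrict_coeFn (hs : MeasurableSet s) (f : Lp ℂ 1 ν) :
    restrict ν hs f =ᵐ[ν] s.indicator f :=
  ((Lp.memLp f).indicator hs).coeFn_toLp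

theorem norm_restrict_le (hs : MeasurableSet s) : ‖restrict ν hs‖ ≤ 1 :=
  LinearMap.mkContinuous_norm_le _ zero_le_one _

theorem tendsto_restrict {s : ℕ → Set X} (hs : ∀ n, MeasurableSet (s n))
    (hmem : ∀ x, ∀ᶠ n in atTop, x ∈ s n) (f : Lp ℂ 1 ν) :
    Tendsto (fun n => restrict ν (hs n) f) atTop (𝓝 f) := by
  rw [Lp.tendsto_Lp_iff_tendsto_eLpNorm']
  have hle : ∀ n, eLpNorm (⇑(restrict ν (hs n) f) - ⇑f) 1 ν =
      ∫⁻ x, (s n)ᶜ.indicator (fun x => ‖f x‖ₑ) x ∂ν := fun n => by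
    rw [eLpNorm_one_eq_lintegral_enorm]
    refine lintegral_congr_ae ?_
    filter_upwards [restrict_coeFn (hs n) f] with x hx
    by_cases h : x ∈ s n <;> simp [hx, h]
  simp only [hle]
  rw [← lintegral_zero (μ := ν)]
  refine tendsto_lintegral_of_dominated_convergence' (fun x => ‖f x‖ₑ)
    (fun n => (Lp.aestronglyMeasurable f).enorm.indicator (hs n).compl)
    (fun n => Eventually.of_forall fun x => Set.indicator_le_self _ _ x) ?_
    (Eventually.of_forall fun x => ?_)
  · rw [← eLpNorm_one_eq_lintegral_enorm]
    exact Lp.eLpNorm_ne_top f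
  · refine tendsto_const_nhds.congr' ?_
    filter_upwards [hmem x] with n hn
    simp [hn]

end Restrict

variable {G : Type*} [TopologicalSpace G] [Group G] [IsTopologicalGroup G]
  [LocallyCompactSpace G] [MeasurableSpace G] [BorelSpace G]
  (ω : Weight G) (μ : Measure G) [μ.IsHaarMeasure] [μ.Regular]

theorem norm_lTranslate (g : G) (f : Beurling ω μ) :
    ‖lTranslate ω μ g f‖ = ∫ x, ω (g * x) * ‖f x‖ ∂μ := by
  rw [norm_eq, ← integral_mul_left_eq_self _ g]
  refine integral_congr_ae ?_
  filter_upwards [(quasi_mul_left μ g).ae (lTranslate_coeFn ω μ g f)] with x hx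
  rw [hx, inv_mul_cancel_left, norm_mul, Complex.norm_real, Real.norm_of_nonneg (ω.pos' _).le]

theorem norm_rTranslate (g : G) (f : Beurling ω μ) :
    ‖rTranslate ω μ g f‖ = ∫ x, ω (x * g) * ‖f x‖ ∂μ := by
  have h := (Homeomorph.mulRight g⁻¹).measurableEmbedding.integral_map (μ := μ)
    fun x => ω (x * g) * ‖f x‖
  have hΔ : (Measure.modularCharacter g : ℝ≥0) * Measure.modularCharacter g⁻¹ = 1 := by
    rw [← map_mul, mul_inv_cancel, map_one]
  rw [Homeomorph.coe_mulRight, map_mul_right, integral_smul_nnreal_measure, NNReal.smul_def,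
    smul_eq_mul] at h
  calc ‖rTranslate ω μ g f‖
      = ∫ x, (Measure.modularCharacter g : ℝ≥0) * (ω (x * g⁻¹ * g) * ‖f (x * g⁻¹)‖) ∂μ := by
        rw [norm_eq]
        refine integral_congr_ae ?_
        filter_upwards [rTranslate_coeFn ω μ g f] with x hx
        rw [hx, norm_mul, norm_mul, Complex.norm_real, Complex.norm_real,
          Real.norm_of_nonneg (ω.pos' _).le, Real.norm_of_nonneg (NNReal.coe_nonneg _),
          inv_mul_cancel_right]
        ring
    _ = _ := by
        rw [integral_const_mul, ← h, ← mul_assoc, ← NNReal.coe_mul, hΔ, NNReal.coe_one, one_mul]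

theorem lTranslate_one (f : Beurling ω μ) : lTranslate ω μ 1 f = f := by
  refine Lp.ext ((withDensity_absolutelyContinuous _ _ : ω.measure μ ≪ μ).ae_le ?_)
  filter_upwards [lTranslate_coeFn ω μ 1 f] with x hx
  rw [hx, inv_one, one_mul]

theorem lTranslate_self_inv (g : G) (f : Beurling ω μ) :
    lTranslate ω μ g (lTranslate ω μ g⁻¹ f) = f := by
  rw [← lTranslate_mul, mul_inv_cancel, lTranslate_one]

theorem quasi_mul_right (g : G) : Measure.QuasiMeasurePreserving (fun x => x * g) μ μ :=
  ⟨(continuous_mul_const g).measurable, by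
    rw [map_mul_right]; exact Measure.smul_absolutelyContinuous⟩

theorem rTranslate_self_inv (g : G) (f : Beurling ω μ) :
    rTranslate ω μ g (rTranslate ω μ g⁻¹ f) = f := by
  have hΔ : (Measure.modularCharacter g : ℝ≥0) * Measure.modularCharacter g⁻¹ = 1 := by
    rw [← map_mul, mul_inv_cancel, map_one]
  refine Lp.ext ((withDensity_absolutelyContinuous _ _ : ω.measure μ ≪ μ).ae_le ?_)
  filter_upwards [rTranslate_coeFn ω μ g (rTranslate ω μ g⁻¹ f),
    (quasi_mul_right μ g⁻¹).ae (rTranslate_coeFn ω μ g⁻¹ f)] with x h1 h2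
  rw [h1, h2, ← mul_assoc, ← Complex.ofReal_mul, ← NNReal.coe_mul, hΔ]
  simp

/-- The points where `ω x` and `ω x⁻¹` are at most `n`. -/
def sublevel (n : ℕ) : Set G := {x | ω x ≤ n ∧ ω x⁻¹ ≤ n}

theorem measurableSet_sublevel (n : ℕ) : MeasurableSet (sublevel ω n) :=
  ((isClosed_le ω.continuous_toFun continuous_const).inter
    (isClosed_le (ω.continuous_toFun.comp continuous_inv) continuous_const)).measurableSet

theorem eventually_mem_sublevel (x : G) : ∀ᶠ n in atTop, x ∈ sublevel ω n :=
  (tendsto_natCast_atTop_atTop.eventually_ge_atTop (ω x)).and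
    (tendsto_natCast_atTop_atTop.eventually_ge_atTop (ω x⁻¹))

/-- Restriction to the sublevel set `sublevel ω n`, as an operator on `L¹(G, ω)`. -/
def trunc (n : ℕ) : Beurling ω μ →L[ℂ] Beurling ω μ :=
  restrict (ω.measure μ) (measurableSet_sublevel ω n)

theorem norm_trunc_apply_mul_le {c : ℝ} {n : ℕ} {w : G → ℝ} (hw : Continuous w)
    (hle : ∀ x, c ≤ ω x⁻¹ * w x) (hle' : ∃ C, ∀ x, w x ≤ C * ω x) (hw0 : ∀ x, 0 ≤ w x)
    (f : Beurling ω μ) : c * ‖trunc ω μ n f‖ ≤ n ^ 2 * ∫ x, w x * ‖f x‖ ∂μ := by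
  obtain ⟨C, hC⟩ := hle'
  have hint : Integrable (fun x => w x * ‖f x‖) μ := by
    refine ((integrable_weight_mul ω μ f).norm.const_mul C).mono'
      (hw.measurable.aestronglyMeasurable.mul (aestronglyMeasurable ω μ f).norm)
      (Eventually.of_forall fun x => ?_)
    rw [norm_mul, norm_mul, norm_norm, Complex.norm_real, Real.norm_of_nonneg (hw0 x),
      Real.norm_of_nonneg (ω.pos' x).le, ← mul_assoc]
    exact mul_le_mul_of_nonneg_right (hC x) (norm_nonneg _)
  rw [norm_eq, ← integral_const_mul, ← integral_const_mul]
  refine integral_mono_ae ((integrable_weight_mul ω μ _).norm.const_mul c)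
    (hint.const_mul _) ?_
  filter_upwards [(ac_measure ω μ).ae_le (restrict_coeFn (measurableSet_sublevel ω n) f)] with x hx
  simp only [trunc, hx]
  by_cases h : x ∈ sublevel ω n
  · rw [Set.indicator_of_mem h, norm_mul, Complex.norm_real, Real.norm_of_nonneg (ω.pos' x).le,
      ← mul_assoc, ← mul_assoc]
    refine mul_le_mul_of_nonneg_right ?_ (norm_nonneg _)
    calc c * ω x ≤ (ω x⁻¹ * w x) * ω x := mul_le_mul_of_nonneg_right (hle x) (ω.pos' x).le
      _ ≤ (n * w x) * n := by
        have := h.1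
        have := h.2
        have := hw0 x
        have := (ω.pos' x).le
        gcongr
      _ = n ^ 2 * w x := by ring
  · rw [Set.indicator_of_notMem h, mul_zero, norm_zero, mul_zero]
    exact mul_nonneg (sq_nonneg _) (mul_nonneg (hw0 x) (norm_nonneg _))

theorem norm_trunc_comp_lTranslate_le (n : ℕ) (g : G) :
    ‖(trunc ω μ n).comp (lTranslate ω μ g⁻¹)‖ ≤ n ^ 2 / ω g := by
  refine ContinuousLinearMap.opNorm_le_bound _ (div_nonneg (sq_nonneg _) (ω.pos' g).le) fun f => ?_
  have h := norm_trunc_apply_mul_le ω μ (c := ω g) (n := n) (w := fun x => ω (g * x))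
    (ω.continuous_toFun.comp (continuous_const_mul g))
    (fun x => by simpa [mul_comm] using ω.mul_le' (g * x) x⁻¹)
    ⟨ω g, fun x => ω.mul_le' g x⟩ (fun x => (ω.pos' _).le) (lTranslate ω μ g⁻¹ f)
  rw [← norm_lTranslate, lTranslate_self_inv] at h
  rw [div_mul_eq_mul_div, le_div_iff₀ (ω.pos' g), mul_comm]
  exact h

theorem norm_trunc_comp_rTranslate_le (n : ℕ) (g : G) :
    ‖(trunc ω μ n).comp (rTranslate ω μ g⁻¹)‖ ≤ n ^ 2 / ω g := by
  refine ContinuousLinearMap.opNorm_le_bound _ (div_nonneg (sq_nonneg _) (ω.pos' g).le) fun f => ?_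
  have h := norm_trunc_apply_mul_le ω μ (c := ω g) (n := n) (w := fun x => ω (x * g))
    (ω.continuous_toFun.comp (continuous_mul_const g))
    (fun x => by simpa using ω.mul_le' x⁻¹ (x * g))
    ⟨ω g, fun x => (ω.mul_le' x g).trans_eq (mul_comm _ _)⟩ (fun x => (ω.pos' _).le)
    (rTranslate ω μ g⁻¹ f)
  rw [← norm_rTranslate, rTranslate_self_inv] at h
  rw [div_mul_eq_mul_div, le_div_iff₀ (ω.pos' g), mul_comm]
  exact h

theorem norm_map_trunc_mul_le (n : ℕ) (g : G) (m : ProjTensor (Beurling ω μ)) :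
    ‖ProjTensor.map (trunc ω μ n) (trunc ω μ n) m‖ * (ω g * ω g⁻¹) ≤
      n ^ 4 * ‖conjTensor ω μ g m‖ := by
  have hL : ((trunc ω μ n).comp (lTranslate ω μ g⁻¹)).comp (lTranslate ω μ g) = trunc ω μ n := by
    ext1 f
    have := lTranslate_self_inv ω μ g⁻¹ f
    rw [inv_inv] at this
    simp [this]
  have hR : ((trunc ω μ n).comp (rTranslate ω μ g⁻¹⁻¹)).comp (rTranslate ω μ g⁻¹) =
      trunc ω μ n := by
    ext1 f
    have := rTranslate_self_inv ω μ g⁻¹⁻¹ f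
    rw [inv_inv g⁻¹] at this
    rw [ContinuousLinearMap.comp_apply, ContinuousLinearMap.comp_apply, this]
  have h : ProjTensor.map (trunc ω μ n) (trunc ω μ n) m =
      ProjTensor.map ((trunc ω μ n).comp (lTranslate ω μ g⁻¹))
        ((trunc ω μ n).comp (rTranslate ω μ g⁻¹⁻¹)) (conjTensor ω μ g m) := by
    rw [conjTensor, ProjTensor.map_map, hL, hR]
  have hg := ω.pos' g
  have hg' := ω.pos' g⁻¹
  calc _ ≤ n ^ 2 / ω g * (n ^ 2 / ω g⁻¹) * ‖conjTensor ω μ g m‖ * (ω g * ω g⁻¹) := by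
        rw [h]
        refine mul_le_mul_of_nonneg_right ((ProjTensor.norm_map_le _ _ _).trans ?_)
          (mul_pos hg hg').le
        have := norm_trunc_comp_lTranslate_le ω μ n g
        have := norm_trunc_comp_rTranslate_le ω μ n g⁻¹
        gcongr
    _ = n ^ 4 * ‖conjTensor ω μ g m‖ := by
        field_simp

/-- One nonzero tensor with bounded conjugates under the point masses forces the weight to be
diagonally bounded. -/
theorem diagonallyBounded_of_norm_conjTensor_le {m : ProjTensor (Beurling ω μ)} (hm : m ≠ 0)
    {C : ℝ} (hC : ∀ g, ‖conjTensor ω μ g m‖ ≤ C) : ω.DiagonallyBounded := by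
  have ht := ProjTensor.tendsto_map (P := trunc ω μ)
    (fun n => norm_restrict_le (measurableSet_sublevel ω n))
    (tendsto_restrict (measurableSet_sublevel ω) (eventually_mem_sublevel ω)) m
  obtain ⟨n, hn⟩ := (ht.eventually_ne hm).exists
  refine ⟨n ^ 4 * C / ‖ProjTensor.map (trunc ω μ n) (trunc ω μ n) m‖, ?_⟩
  rintro _ ⟨g, rfl⟩
  rw [le_div_iff₀ (norm_pos_iff.2 hn), mul_comm]
  exact (norm_map_trunc_mul_le ω μ n g m).trans
    (mul_le_mul_of_nonneg_left (hC g) (pow_nonneg n.cast_nonneg 4))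

theorem exists_ne_zero : ∃ a : Beurling ω μ, a ≠ 0 := by
  obtain ⟨⟨k, hk⟩, hc, -, h1⟩ : ∃ k : C(G, ℝ), HasCompactSupport k ∧ 0 ≤ k ∧ k 1 ≠ 0 :=
    exists_continuous_nonneg_pos 1
  have hk' : Continuous fun x => (k x : ℂ) := Complex.continuous_ofReal.comp hk
  have hc' : HasCompactSupport fun x => (k x : ℂ) :=
    hc.comp_left (g := fun r : ℝ => (r : ℂ)) (by simp)
  refine ⟨(memLp_of_compactSupport ω μ hk' hc').toLp _, fun h0 => h1 ?_⟩
  have h := (ac_measure ω μ).ae_le ((memLp_of_compactSupport ω μ hk' hc').coeFn_toLp.symm.trans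
    (h0 ▸ Lp.coeFn_zero ℂ 1 (ω.measure μ)))
  have := congrFun (Continuous.ae_eq_iff_eq μ hk' continuous_const |>.1 h) 1
  exact Complex.ofReal_eq_zero.1 this

end Beurling

end

theorem theorem3p1 {G : Type*} [TopologicalSpace G] [Group G] [IsTopologicalGroup G]
    [LocallyCompactSpace G] [MeasurableSpace G] [BorelSpace G]
    (μ : Measure G) [μ.IsHaarMeasure] [μ.Regular] (ω : Weight G)
    {ι : Type*} [Preorder ι] [IsDirectedOrder ι] [Nonempty ι]
    (m : ι → ProjTensor (Beurling ω μ))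
    (hm : IsApproximateDiagonal m)
    (hunif : TendstoUniformly (fun i g => m i - Beurling.conjTensor ω μ g (m i)) 0 atTop) :
    ω.DiagonallyBounded := by
  obtain ⟨a, ha⟩ := Beurling.exists_ne_zero ω μ
  obtain ⟨i, hi, hne⟩ := ((Metric.tendstoUniformly_iff.1 hunif 1 one_pos).and
    ((hm.approx a).eventually_ne ha)).exists
  refine Beurling.diagonallyBounded_of_norm_conjTensor_le ω μ (m := m i)
    (fun h => hne (by rw [h, map_zero, mul_zero])) (C := ‖m i‖ + 1) fun g => ?_
  have h := hi g
  rw [Pi.zero_apply, dist_zero_left] at h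
  have := norm_sub_norm_le (Beurling.conjTensor ω μ g (m i)) (m i)
  rw [norm_sub_rev] at this
  linarith
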